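/- **Setting.** A probability distribution $\mu$ on $\mathbb{R}^d$ is *quasi-infinitely divisible* if its characteristic function satisfies $\widehat\mu(z)=\widehat\mu_1(z)/\widehat\mu_2(z)$ for all $z\in\mathbb{R}^d$, with infinitely divisible distributions $\mu_1,\mu_2$ on $\mathbb{R}^d$. Let $\nu$ be a real-valued function on the Borel sets $B\subset\mathbb{R}^d$ bounded away from $0$ such that, for every $r>0$, its restriction to the Borel subsets of $\{|x|\ge r\}$ is a finite signed measure; its positive and negative parts $\nu^+,\nu^-$ are the unique Borel measures on $\mathbb{R}^d$ that give no mass to $\{0\}$ and that, for every $r>0$, agree on the Borel subsets of $\{|x|\ge r\}$ with the positive and negative parts (Jordan decomposition) of that restriction. A function $f$ is $\nu$-integrable if it is integrable with respect to $\nu^+$ and $\nu^-$, and then $\int f\,d\nu:=\int f\,d\nu^+-\int f\,d\nu^-$. One calls $\nu$ a *quasi-Lévy type measure* if $x\mapsto 1\wedge|x|^2$ is $\nu$-integrable. A quasi-infinitely divisible distribution $\mu$ has *characteristic triplet* $(A,\nu,\gamma)$, where $A\in\mathbb{R}^{d\times d}$ is symmetric, $\nu$ is a quasi-Lévy type measure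 on $\mathbb{R}^d$ and $\gamma\in\mathbb{R}^d$, if for all $z\in\mathbb{R}^d$ $$\widehat\mu(z)=\exp\Big(i\langle\gamma,z\rangle-\tfrac12\langle z,Az\rangle+\int_{\mathbb{R}^d}\big(e^{i\langle z,x\rangle}-1-i\langle z,x\rangle\mathbf 1_{[0,1]}(|x|)\big)\,\nu(dx)\Big).$$ With $S^{d-1}=\{\xi\in\mathbb{R}^d:|\xi|=1\}$ put, for $r>0$, $$G^-(r)=\sup_{\xi\in S^{d-1}}\xi^T\Big(\int_{|x|\le r}xx^T\,\nu^-(dx)\Big)\xi,\qquad G^+(r)=\inf_{\xi\in S^{d-1}}\xi^T\Big(\int_{|x|\le r}xx^T\,\nu^+(dx)\Big)\xi .$$ **Statement.** Let $\mu$ be a quasi-infinitely divisible distribution on $\mathbb{R}^d$ with characteristic triplet $(A,\nu,\gamma)$. Suppose that $A$ is (strictly) positive definite, or that there exists some $\beta\in(0,2)$ such that $$\liminf_{r\downarrow0}r^{-\beta}G^+(r)>\limsup_{r\downarrow0}r^{-\beta}G^-(r)=0,$$ where the limits inferior and superior are taken in $[-\infty,\infty]$ (so the limit inferior may be $+\infty$).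 Then $\mu$ is absolutely continuous with respect to Lebesgue measure, and it has a Lebesgue density $f:\mathbb{R}^d\to[0,\infty)$ that is infinitely often differentiable and such that $f$ and all its derivatives tend to $0$ as $|x|\to\infty$. -/

import Mathlib

open MeasureTheory Filter Topology
open scoped ContDiff

namespace QID

/-- `ℝ^d` with the Euclidean norm. -/
abbrev E (d : ℕ) : Type := EuclideanSpace ℝ (Fin d)

/-! ### Infinitely divisible and quasi-infinitely divisible distributions -/

/-- The `n`-fold convolution of `ρ` with itself. -/
noncomputable def convPow {d : ℕ} (ρ : Measure (E d)) : ℕ → Measure (E d)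
  | 0 => Measure.dirac 0
  | n + 1 => (convPow ρ n).conv ρ

/-- `μ` is an infinitely divisible probability distribution on `ℝ^d`: it has an `n`-th convolution
root, which is a probability distribution, for every `n ≥ 1`. -/
def IsInfinitelyDivisible {d : ℕ} (μ : Measure (E d)) : Prop :=
  IsProbabilityMeasure μ ∧
    ∀ n : ℕ, 1 ≤ n → ∃ ρ : Measure (E d), IsProbabilityMeasure ρ ∧ convPow ρ n = μ

/-- `μ` is a quasi-infinitely divisible probability distribution on `ℝ^d`: its characteristic
function is the quotient of those of two infinitely divisible distributions. (The denominator
has no zeros, since characteristic functions of infinitely divisible distributions have none.) -/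
def IsQuasiInfinitelyDivisible {d : ℕ} (μ : Measure (E d)) : Prop :=
  IsProbabilityMeasure μ ∧
    ∃ μ₁ μ₂ : Measure (E d), IsInfinitelyDivisible μ₁ ∧ IsInfinitelyDivisible μ₂ ∧
      ∀ z : E d, charFun μ z = charFun μ₁ z / charFun μ₂ z

/-! ### Quasi-Lévy type measures -/

/-- The points of norm at least `r`. -/
def far (d : ℕ) (r : ℝ) : Set (E d) := {x | r ≤ ‖x‖}

lemma measurableSet_far (d : ℕ) (r : ℝ) : MeasurableSet (far d r) :=
  measurableSet_le measurable_const measurable_norm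

lemma far_anti {d : ℕ} {r s : ℝ} (h : r ≤ s) : far d s ⊆ far d r :=
  fun _ hx => le_trans h hx

/-- The system of all Borel sets that are bounded away from the origin. -/
abbrev AwayFromZero (d : ℕ) : Type :=
  {B : Set (E d) // MeasurableSet B ∧ ∃ r : ℝ, 0 < r ∧ B ⊆ far d r}

/-- A real set function on the Borel sets bounded away from the origin, whose restriction to the
Borel subsets of `{x | r ≤ |x|}` is a finite signed measure for every `r > 0`. -/
structure LocalSignedMeasure (d : ℕ) where
  toFun : AwayFromZero d → ℝ
  map_empty : toFun ⟨∅, MeasurableSet.empty, 1, one_pos, Set.empty_subset _⟩ = 0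
  hasSum_iUnion : ∀ (r : ℝ) (hr : 0 < r) (B : ℕ → Set (E d)) (hB : ∀ n, MeasurableSet (B n))
    (hBr : ∀ n, B n ⊆ far d r), Pairwise (Function.onFun Disjoint B) →
      HasSum (fun n => toFun ⟨B n, hB n, r, hr, hBr n⟩)
        (toFun ⟨⋃ n, B n, MeasurableSet.iUnion hB, r, hr, Set.iUnion_subset hBr⟩)

namespace LocalSignedMeasure

variable {d : ℕ}

open scoped Classical in
/-- The restriction of `ν` to `{x | r ≤ |x|}`, as the signed measure `B ↦ ν (B ∩ {x | r ≤ |x|})`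
on `ℝ^d`, for `r > 0`. -/
noncomputable def restr (ν : LocalSignedMeasure d) (r : ℝ) (hr : 0 < r) :
    SignedMeasure (E d) where
  measureOf' B :=
    if hB : MeasurableSet B then
      ν.toFun ⟨B ∩ far d r, hB.inter (measurableSet_far d r), r, hr, Set.inter_subset_right⟩
    else 0
  empty' := by
    simp only [MeasurableSet.empty, dite_true, Set.empty_inter]
    exact ν.map_empty
  not_measurable' B hB := by simp [hB]
  m_iUnion' f hf hd := by
    have h := ν.hasSum_iUnion r hr (fun n => f n ∩ far d r)
      (fun n => (hf n).inter (measurableSet_far d r)) (fun n => Set.inter_subset_right)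
      (fun i j hij => (hd hij).mono Set.inter_subset_left Set.inter_subset_left)
    simp only [hf, MeasurableSet.iUnion hf, dite_true, Set.iUnion_inter]
    exact h

lemma restr_apply (ν : LocalSignedMeasure d) {r : ℝ} (hr : 0 < r) {B : Set (E d)}
    (hB : MeasurableSet B) : ν.restr r hr B =
      ν.toFun ⟨B ∩ far d r, hB.inter (measurableSet_far d r), r, hr, Set.inter_subset_right⟩ :=
  dif_pos hB

/-- The numbers `1, 1/2, 1/3, …`. -/
noncomputable def rad (n : ℕ) : ℝ := 1 / ((n : ℝ) + 1)

lemma rad_pos (n : ℕ) : 0 < rad n := Nat.one_div_pos_of_nat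

/-- The shells `{1 ≤ |x|}, {1/2 ≤ |x| < 1}, {1/3 ≤ |x| < 1/2}, …`. -/
def shell (d n : ℕ) : Set (E d) := disjointed (fun n => far d (rad n)) n

/-- The positive part `ν⁺` of `ν`, a Borel measure on all of `ℝ^d`, glued from the positive parts
of the restrictions of `ν`; see `posPart_singleton_zero`, `posPart_apply` and `posPart_unique`. -/
noncomputable def posPart (ν : LocalSignedMeasure d) : Measure (E d) :=
  Measure.sum fun n =>
    ((ν.restr (rad n) (rad_pos n)).toJordanDecomposition.posPart).restrict (shell d n)

/-- The negative part `ν⁻` of `ν`, a Borel measure on all of `ℝ^d`, glued from the negative parts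
of the restrictions of `ν`; see `negPart_singleton_zero`, `negPart_apply` and `negPart_unique`. -/
noncomputable def negPart (ν : LocalSignedMeasure d) : Measure (E d) :=
  Measure.sum fun n =>
    ((ν.restr (rad n) (rad_pos n)).toJordanDecomposition.negPart).restrict (shell d n)

/-! #### The parts are those of the restrictions, and are determined by that -/

lemma measurableSet_shell (d n : ℕ) : MeasurableSet (shell d n) :=
  MeasurableSet.disjointed (fun _ => measurableSet_far d _) n

lemma shell_subset (d n : ℕ) : shell d n ⊆ far d (rad n) := disjointed_subset _ n

lemma iUnion_far_rad (d : ℕ) : (⋃ n, far d (rad n)) = {0}ᶜ := by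
  ext x
  simp only [Set.mem_iUnion, far, Set.mem_ofPred_eq, Set.mem_compl_iff, Set.mem_singleton_iff]
  constructor
  · rintro ⟨n, hn⟩ rfl
    rw [norm_zero] at hn
    exact absurd hn (not_le.2 (rad_pos n))
  · intro hx
    obtain ⟨n, hn⟩ := exists_nat_one_div_lt (norm_pos_iff.2 hx)
    exact ⟨n, hn.le⟩

lemma iUnion_shell (d : ℕ) : (⋃ n, shell d n) = {0}ᶜ := by
  rw [← iUnion_far_rad]
  exact iUnion_disjointed

lemma restr_jordan (ν : LocalSignedMeasure d) {r s : ℝ} (hr : 0 < r) (hs : 0 < s) (h : r ≤ s) :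
    (ν.restr s hs).toJordanDecomposition.posPart
        = ((ν.restr r hr).toJordanDecomposition.posPart).restrict (far d s) ∧
      (ν.restr s hs).toJordanDecomposition.negPart
        = ((ν.restr r hr).toJordanDecomposition.negPart).restrict (far d s) := by
  set j := (ν.restr r hr).toJordanDecomposition with hj
  let j' : JordanDecomposition (E d) :=
    { posPart := j.posPart.restrict (far d s)
      negPart := j.negPart.restrict (far d s)
      mutuallySingular :=
        j.mutuallySingular.mono Measure.restrict_le_self
          Measure.restrict_le_self }
  have key : ν.restr s hs = j'.toSignedMeasure := by
    ext B hB
    have hBs := hB.inter (measurableSet_far d s)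
    rw [JordanDecomposition.toSignedMeasure, Measure.toSignedMeasure_sub_apply hB,
      measureReal_restrict_apply hB, measureReal_restrict_apply hB,
      ← SignedMeasure.apply_eq_posPart_real_sub_negPart_real _ hBs]
    rw [restr_apply ν hs hB, restr_apply ν hr hBs]
    congr 2
    rw [Set.inter_assoc, Set.inter_eq_left.2 (far_anti h)]
  rw [SignedMeasure.toJordanDecomposition_eq key]
  exact ⟨rfl, rfl⟩

lemma restr_jordan_apply (ν : LocalSignedMeasure d) {r s : ℝ} (hr : 0 < r) (hs : 0 < s)
    {B : Set (E d)} (hB : MeasurableSet B) (hBr : B ⊆ far d r) (hBs : B ⊆ far d s) :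
    (ν.restr s hs).toJordanDecomposition.posPart B
        = (ν.restr r hr).toJordanDecomposition.posPart B ∧
      (ν.restr s hs).toJordanDecomposition.negPart B
        = (ν.restr r hr).toJordanDecomposition.negPart B := by
  rcases le_total r s with h | h
  · obtain ⟨h₁, h₂⟩ := ν.restr_jordan hr hs h
    rw [h₁, h₂, Measure.restrict_apply hB, Measure.restrict_apply hB, Set.inter_eq_left.2 hBs]
    exact ⟨rfl, rfl⟩
  · obtain ⟨h₁, h₂⟩ := ν.restr_jordan hs hr h
    rw [h₁, h₂, Measure.restrict_apply hB, Measure.restrict_apply hB, Set.inter_eq_left.2 hBr]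
    exact ⟨rfl, rfl⟩

lemma tsum_shell (m : Measure (E d)) {r : ℝ} (hr : 0 < r) {B : Set (E d)} (hB : MeasurableSet B)
    (hBr : B ⊆ far d r) : ∑' n, m (B ∩ shell d n) = m B := by
  rw [← measure_iUnion]
  · congr 1
    rw [← Set.inter_iUnion, iUnion_shell, Set.inter_eq_left]
    rintro x hx rfl
    have := hBr hx
    simp only [far, Set.mem_ofPred_eq, norm_zero] at this
    exact absurd this (not_le.2 hr)
  · intro i j hij
    exact (disjoint_disjointed (fun n => far d (rad n)) hij).mono Set.inter_subset_right
      Set.inter_subset_right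
  · exact fun n => hB.inter (measurableSet_shell d n)

theorem posPart_apply (ν : LocalSignedMeasure d) {r : ℝ} (hr : 0 < r) {B : Set (E d)}
    (hB : MeasurableSet B) (hBr : B ⊆ far d r) :
    ν.posPart B = (ν.restr r hr).toJordanDecomposition.posPart B := by
  rw [posPart, Measure.sum_apply _ hB, ← tsum_shell _ hr hB hBr]
  congr 1
  ext n
  rw [Measure.restrict_apply hB]
  exact (ν.restr_jordan_apply hr (rad_pos n) (hB.inter (measurableSet_shell d n))
    (Set.inter_subset_left.trans hBr) (Set.inter_subset_right.trans (shell_subset d n))).1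

theorem negPart_apply (ν : LocalSignedMeasure d) {r : ℝ} (hr : 0 < r) {B : Set (E d)}
    (hB : MeasurableSet B) (hBr : B ⊆ far d r) :
    ν.negPart B = (ν.restr r hr).toJordanDecomposition.negPart B := by
  rw [negPart, Measure.sum_apply _ hB, ← tsum_shell _ hr hB hBr]
  congr 1
  ext n
  rw [Measure.restrict_apply hB]
  exact (ν.restr_jordan_apply hr (rad_pos n) (hB.inter (measurableSet_shell d n))
    (Set.inter_subset_left.trans hBr) (Set.inter_subset_right.trans (shell_subset d n))).2

lemma singleton_zero_inter_shell (d n : ℕ) : ({0} : Set (E d)) ∩ shell d n = ∅ := by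
  rw [Set.singleton_inter_eq_empty]
  intro h
  have : (0 : E d) ∈ (⋃ n, shell d n) := Set.mem_iUnion.2 ⟨n, h⟩
  rw [iUnion_shell] at this
  exact this rfl

theorem posPart_singleton_zero (ν : LocalSignedMeasure d) : ν.posPart {0} = 0 := by
  rw [posPart, Measure.sum_apply _ (measurableSet_singleton 0)]
  simp [Measure.restrict_apply, singleton_zero_inter_shell]

theorem negPart_singleton_zero (ν : LocalSignedMeasure d) : ν.negPart {0} = 0 := by
  rw [negPart, Measure.sum_apply _ (measurableSet_singleton 0)]
  simp [Measure.restrict_apply, singleton_zero_inter_shell]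

lemma measure_eq_of_far {m m' : Measure (E d)} (h₀ : m {0} = m' {0})
    (h : ∀ r : ℝ, 0 < r → ∀ B, MeasurableSet B → B ⊆ far d r → m B = m' B) : m = m' := by
  have hs : ∀ m : Measure (E d), ∀ B, MeasurableSet B →
      m (B \ {0}) = ∑' n, m (B ∩ shell d n) := by
    intro m B hB
    rw [← measure_iUnion, ← Set.inter_iUnion, iUnion_shell]
    · rfl
    · intro i j hij
      exact (disjoint_disjointed (fun n => far d (rad n)) hij).mono Set.inter_subset_right
        Set.inter_subset_right
    · exact fun n => hB.inter (measurableSet_shell d n)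
  ext B hB
  rw [← measure_inter_add_sdiff B (measurableSet_singleton (0 : E d)), hs m B hB,
    ← measure_inter_add_sdiff (μ := m') B (measurableSet_singleton (0 : E d)), hs m' B hB]
  congr 1
  · by_cases hx : (0 : E d) ∈ B
    · rw [Set.inter_eq_right.2 (Set.singleton_subset_iff.2 hx), h₀]
    · rw [Set.inter_singleton_eq_empty.2 hx]; simp
  · congr 1
    ext n
    exact h (rad n) (rad_pos n) _ (hB.inter (measurableSet_shell d n))
      (Set.inter_subset_right.trans (shell_subset d n))

theorem posPart_unique (ν : LocalSignedMeasure d) (m : Measure (E d)) (h₀ : m {0} = 0)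
    (h : ∀ (r : ℝ) (hr : 0 < r) (B : Set (E d)), MeasurableSet B → B ⊆ far d r →
      m B = (ν.restr r hr).toJordanDecomposition.posPart B) : m = ν.posPart :=
  measure_eq_of_far (h₀.trans ν.posPart_singleton_zero.symm)
    fun r hr B hB hBr => (h r hr B hB hBr).trans (ν.posPart_apply hr hB hBr).symm

theorem negPart_unique (ν : LocalSignedMeasure d) (m : Measure (E d)) (h₀ : m {0} = 0)
    (h : ∀ (r : ℝ) (hr : 0 < r) (B : Set (E d)), MeasurableSet B → B ⊆ far d r →
      m B = (ν.restr r hr).toJordanDecomposition.negPart B) : m = ν.negPart :=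
  measure_eq_of_far (h₀.trans ν.negPart_singleton_zero.symm)
    fun r hr B hB hBr => (h r hr B hB hBr).trans (ν.negPart_apply hr hB hBr).symm

/-- `f` is integrable with respect to `ν`. -/
def IntegrableWrt (ν : LocalSignedMeasure d) {F : Type*} [NormedAddCommGroup F]
    (f : E d → F) : Prop :=
  Integrable f ν.posPart ∧ Integrable f ν.negPart

/-- The integral `∫ f dν = ∫ f dν⁺ - ∫ f dν⁻` of a `ν`-integrable function. -/
noncomputable def integral (ν : LocalSignedMeasure d) (f : E d → ℂ) : ℂ :=
  (∫ x, f x ∂ν.posPart) - ∫ x, f x ∂ν.negPart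

/-- `ν` is a quasi-Lévy type measure: `x ↦ 1 ∧ |x|²` is `ν`-integrable. -/
def IsQuasiLevyType (ν : LocalSignedMeasure d) : Prop :=
  ν.IntegrableWrt fun x : E d => min (1 : ℝ) (‖x‖ ^ 2)

end LocalSignedMeasure

/-! ### The Lévy–Khintchine representation -/

variable {d : ℕ}

/-- The standard representation function `x ↦ x 1_{[0,1]}(|x|)`. -/
noncomputable def stdRepr (x : E d) : E d :=
  Set.indicator {y : E d | ‖y‖ ≤ 1} id x

/-- The integrand `e^{i⟨z,x⟩} - 1 - i⟨z, x 1_{[0,1]}(|x|)⟩`. -/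
noncomputable def levyKernel (z x : E d) : ℂ :=
  Complex.exp (Complex.I * (inner ℝ z x : ℝ)) - 1 - Complex.I * (inner ℝ z (stdRepr x) : ℝ)

/-- The characteristic exponent
`i⟨γ,z⟩ - ⟨z,Az⟩/2 + ∫ (e^{i⟨z,x⟩} - 1 - i⟨z, x 1_{[0,1]}(|x|)⟩) ν(dx)`. -/
noncomputable def charExponent (A : Matrix (Fin d) (Fin d) ℝ) (ν : LocalSignedMeasure d)
    (γ z : E d) : ℂ :=
  Complex.I * (inner ℝ γ z : ℝ) - (1 / 2 : ℂ) * ((z.ofLp ⬝ᵥ A.mulVec z.ofLp : ℝ) : ℂ)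
    + ν.integral (levyKernel z)

/-- `(A, ν, γ)` is the (standard) characteristic triplet of `μ`. -/
def HasCharTriplet (μ : Measure (E d)) (A : Matrix (Fin d) (Fin d) ℝ)
    (ν : LocalSignedMeasure d) (γ : E d) : Prop :=
  A.IsSymm ∧ ν.IsQuasiLevyType ∧
    ∀ z : E d, charFun μ z = Complex.exp (charExponent A ν γ z)

/-! ### The functions `G⁺` and `G⁻` -/

/-- The matrix `∫_{|x| ≤ r} x xᵀ m(dx)`. -/
noncomputable def truncMoment (m : Measure (E d)) (r : ℝ) : Matrix (Fin d) (Fin d) ℝ :=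
  Matrix.of fun i j => ∫ x in {x : E d | ‖x‖ ≤ r}, x i * x j ∂m

/-- `G⁻(r) = sup_{|ξ| = 1} ξᵀ (∫_{|x| ≤ r} x xᵀ ν⁻(dx)) ξ`. -/
noncomputable def GMinus (ν : LocalSignedMeasure d) (r : ℝ) : ℝ :=
  ⨆ ξ : Metric.sphere (0 : E d) 1,
    (ξ : E d).ofLp ⬝ᵥ (truncMoment ν.negPart r).mulVec (ξ : E d).ofLp

/-- `G⁺(r) = inf_{|ξ| = 1} ξᵀ (∫_{|x| ≤ r} x xᵀ ν⁺(dx)) ξ`. -/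
noncomputable def GPlus (ν : LocalSignedMeasure d) (r : ℝ) : ℝ :=
  ⨅ ξ : Metric.sphere (0 : E d) 1,
    (ξ : E d).ofLp ⬝ᵥ (truncMoment ν.posPart r).mulVec (ξ : E d).ofLp

/-- The Orey-type condition
`liminf_{r → 0} r^{-β} G⁺(r) > limsup_{r → 0} r^{-β} G⁻(r) = 0`; the limits inferior and
superior are taken in the extended reals. -/
def OreyCondition (ν : LocalSignedMeasure d) (β : ℝ) : Prop :=
  limsup (fun r : ℝ => ((r ^ (-β) * GMinus ν r : ℝ) : EReal)) (𝓝[>] 0)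
      < liminf (fun r : ℝ => ((r ^ (-β) * GPlus ν r : ℝ) : EReal)) (𝓝[>] 0) ∧
    limsup (fun r : ℝ => ((r ^ (-β) * GMinus ν r : ℝ) : EReal)) (𝓝[>] 0) = 0

end QID

/-! The characteristic function decays like `exp (-c * ‖z‖ ^ α)` with `α > 0`; hence it is
integrable against every power of `‖z‖`, and Fourier inversion yields a smooth density whose
derivatives vanish at infinity by the Riemann–Lebesgue lemma.

For the decay, drift and compensator only rotate the phase, so `log |μ̂(z)|` is `-⟨z,Az⟩/2 - ∫ (1 -
cos⟨z,x⟩) dν⁺ + ∫ (1 - cos⟨z,x⟩) dν⁻` (`HasCharTriplet.norm_charFun`). Only the `ν⁻` term can hurt.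

If `A` is positive definite, the Gaussian term is of order `|z|²`, while the `ν⁻` term is `o(|z|²)`
by dominated convergence.

Under the Orey condition, the jumps of `ν⁺` of size at most `1/|z|` already contribute at least a
constant times `|z|² G⁺(1/|z|)`, which is bounded below by a multiple of `|z|^(2-β)`. The `ν⁻` term
is at most `2 ∫ min(1, |z|²|x|²) dν⁻`. Since `G⁻` sees only small jumps, this integral is compared
at `R` and `R/2`, and the dyadic sum turns `G⁻(r) = o(r^β)` into `o(R^(2-β))`. The Gaussian term
does no harm: boundedness of `μ̂` forces `A` to be positive semidefinite even for signed `ν`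
(`HasCharTriplet.quadForm_nonneg`). -/

namespace QID

/-! ### Densities from integrable characteristic functions -/

section Density

open FourierTransform

variable {V : Type*} [NormedAddCommGroup V] [InnerProductSpace ℝ V] [FiniteDimensional ℝ V]
  [MeasurableSpace V] [BorelSpace V]

/-- The characteristic function in the normalization of the Fourier transform. -/
noncomputable def scaledCharFun (μ : Measure V) (w : V) : ℂ := charFun μ ((2 * Real.pi) • w)

omit [FiniteDimensional ℝ V] [BorelSpace V] in
lemma scaledCharFun_neg_eq (μ : Measure V) (w : V) :
    scaledCharFun μ (-w) = VectorFourier.fourierIntegral Real.fourierChar μ (innerₗ V) 1 w := by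
  rw [scaledCharFun, charFun_eq_fourierIntegral']
  congr 1
  rw [smul_smul, neg_mul, inv_mul_cancel₀ (by positivity)]
  simp

lemma continuous_scaledCharFun (μ : Measure V) [IsFiniteMeasure μ] :
    Continuous (scaledCharFun μ) := by
  unfold scaledCharFun
  exact continuous_charFun.comp (continuous_const_smul _)

lemma integrable_pow_mul_scaledCharFun {μ : Measure V} {n : ℕ}
    (h : Integrable (fun z => ‖z‖ ^ n * ‖charFun μ z‖)) :
    Integrable (fun z => ‖z‖ ^ n * ‖scaledCharFun μ z‖) := by
  have h2 : (2 * Real.pi : ℝ) ≠ 0 := by positivity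
  have := (h.comp_smul h2).const_mul (((2 * Real.pi) ^ n)⁻¹)
  refine this.congr (ae_of_all _ fun z => ?_)
  simp only [scaledCharFun, norm_smul, mul_pow, Real.norm_eq_abs, abs_of_pos Real.two_pi_pos]
  field_simp

/-- Fubini for the pair `μ`, `volume`, applied to the constant `1` and `𝓕⁻ g`. No integrability of
the characteristic function is needed. -/
lemma integral_scaledCharFun_mul_fourier (μ : Measure V) [IsFiniteMeasure μ] (g : SchwartzMap V ℂ) :
    ∫ w, scaledCharFun μ w * 𝓕 (g : V → ℂ) w = ∫ x, g x ∂μ := by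
  have h1 : Integrable (𝓕⁻ (g : V → ℂ)) := by
    rw [← SchwartzMap.fourierInv_coe]
    exact SchwartzMap.integrable _
  have h2 : 𝓕 (𝓕⁻ (g : V → ℂ)) = g := by
    refine g.continuous.fourier_fourierInv_eq g.integrable ?_
    rw [← SchwartzMap.fourier_coe]
    exact SchwartzMap.integrable _
  have h := VectorFourier.integral_fourierIntegral_smul_eq_flip (μ := μ) (ν := volume)
    (L := innerₗ V) (f := 1) (g := 𝓕⁻ (g : V → ℂ)) Real.continuous_fourierChar
    continuous_inner (integrable_const (1 : ℂ)) h1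
  have h3 : VectorFourier.fourierIntegral Real.fourierChar volume (innerₗ V).flip
      (𝓕⁻ (g : V → ℂ)) = g := by
    rw [flip_innerₗ]
    exact h2
  rw [h3] at h
  simp only [Pi.one_apply, one_smul] at h
  -- The reflection `w ↦ -w` reconciles the opposite signs in the exponents of `charFun` and `𝓕`.
  rw [← h, ← integral_neg_eq_self]
  refine integral_congr_ae (ae_of_all _ fun w => ?_)
  simp only [scaledCharFun_neg_eq, smul_eq_mul]
  rw [Real.fourierInv_eq_fourier_neg]

/-- A second use of the self-adjointness of `𝓕` moves the transform off `g`: `μ` and `𝓕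
(scaledCharFun μ)` agree as tempered distributions. -/
lemma integral_mul_fourier_scaledCharFun {μ : Measure V} [IsFiniteMeasure μ]
    (h : Integrable (scaledCharFun μ)) (g : SchwartzMap V ℂ) :
    ∫ x, g x * 𝓕 (scaledCharFun μ) x = ∫ x, g x ∂μ := by
  have h0 := VectorFourier.integral_fourierIntegral_smul_eq_flip (μ := volume) (ν := volume)
    (L := innerₗ V) (f := scaledCharFun μ) (g := g) Real.continuous_fourierChar
    continuous_inner h g.integrable
  rw [flip_innerₗ] at h0
  rw [← integral_scaledCharFun_mul_fourier]
  refine Eq.trans ?_ h0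
  refine integral_congr_ae (ae_of_all _ fun w => ?_)
  exact mul_comm _ _

/-- The real part of the inverse Fourier transform of the characteristic function. -/
noncomputable def fourierDensity (μ : Measure V) (x : V) : ℝ := (𝓕 (scaledCharFun μ) x).re

/-- Hermitian symmetry `μ̂(-z) = conj μ̂(z)` makes the transform real, so taking the real part loses
nothing. -/
lemma ofReal_fourierDensity (μ : Measure V) (x : V) :
    (fourierDensity μ x : ℂ) = 𝓕 (scaledCharFun μ) x := by
  rw [fourierDensity, ← Complex.conj_eq_iff_re, Real.fourier_eq, ← integral_conj,
    ← integral_neg_eq_self]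
  refine integral_congr_ae (ae_of_all _ fun w => ?_)
  simp only [Circle.smul_def, smul_eq_mul, map_mul, scaledCharFun, smul_neg, charFun_neg,
    Complex.conj_conj, inner_neg_left, neg_neg, ← Circle.coe_inv_eq_conj]
  rw [AddChar.map_neg_eq_inv]

lemma contDiff_fourierDensity {μ : Measure V}
    (h : ∀ n : ℕ, Integrable (fun z => ‖z‖ ^ n * ‖charFun μ z‖)) :
    ContDiff ℝ ∞ (fourierDensity μ) :=
  Complex.reCLM.contDiff.comp
    (Real.contDiff_fourier fun n _ => integrable_pow_mul_scaledCharFun (h n))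

lemma tendsto_iteratedFDeriv_fourierDensity {μ : Measure V} [IsFiniteMeasure μ]
    (h : ∀ n : ℕ, Integrable (fun z => ‖z‖ ^ n * ‖charFun μ z‖)) (n : ℕ) :
    Tendsto (iteratedFDeriv ℝ n (fourierDensity μ)) (cocompact V) (𝓝 0) := by
  have h' : ∀ n : ℕ, Integrable (fun z => ‖z‖ ^ n * ‖scaledCharFun μ z‖) :=
    fun n => integrable_pow_mul_scaledCharFun (h n)
  have hF : ContDiff ℝ ∞ (𝓕 (scaledCharFun μ)) := Real.contDiff_fourier fun n _ => h' n
  have h1 : Tendsto (iteratedFDeriv ℝ n (𝓕 (scaledCharFun μ))) (cocompact V) (𝓝 0) := by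
    -- Each derivative of a Fourier transform is the transform of a function multiplied by powers of
    -- the variable, so Riemann–Lebesgue applies to it.
    rw [Real.iteratedFDeriv_fourier (N := ⊤) (fun n _ => h' n)
      (continuous_scaledCharFun μ).aestronglyMeasurable le_top]
    exact tendsto_integral_exp_inner_smul_cocompact _
  refine squeeze_zero_norm' (Eventually.of_forall fun x => ?_)
    ((tendsto_norm_zero.comp h1).const_mul ‖Complex.reCLM‖ |>.trans (by simp))
  have : fourierDensity μ = Complex.reCLM ∘ 𝓕 (scaledCharFun μ) := rfl
  rw [this]
  exact Complex.reCLM.norm_iteratedFDeriv_comp_left hF.contDiffAt (by exact_mod_cast le_top)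

lemma integral_mul_fourierDensity {μ : Measure V} [IsFiniteMeasure μ]
    (h : Integrable (scaledCharFun μ)) {g : V → ℝ} (hg : ContDiff ℝ ∞ g)
    (hs : HasCompactSupport g) :
    ∫ x, g x * fourierDensity μ x = ∫ x, g x ∂μ := by
  have hs' : HasCompactSupport (fun x => (g x : ℂ)) := hs.comp_left Complex.ofReal_zero
  have hg' : ContDiff ℝ ∞ (fun x => (g x : ℂ)) := Complex.ofRealCLM.contDiff.comp hg
  have := integral_mul_fourier_scaledCharFun h (hs'.toSchwartzMap hg')
  simp only [HasCompactSupport.toSchwartzMap_toFun, ← ofReal_fourierDensity] at this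
  rw [integral_complex_ofReal] at this
  simp only [← Complex.ofReal_mul] at this
  rw [integral_complex_ofReal] at this
  exact_mod_cast this

/-- A bump function supported where the density is negative would have a negative integral against
the density, but a nonnegative one against `μ`. -/
lemma fourierDensity_nonneg {μ : Measure V} [IsFiniteMeasure μ]
    (h : Integrable (scaledCharFun μ)) (hc : Continuous (fourierDensity μ)) (x : V) :
    0 ≤ fourierDensity μ x := by
  by_contra! hx
  obtain ⟨δ, hδ, hball⟩ := Metric.eventually_nhds_iff_ball.1 (hc.continuousAt.eventually_lt_const hx)
  let b : ContDiffBump x := ⟨δ / 2, δ, by positivity, by linarith⟩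
  have hI : ∫ y, b y * fourierDensity μ y = ∫ y, b y ∂μ :=
    integral_mul_fourierDensity h b.contDiff b.hasCompactSupport
  have h0 : 0 ≤ ∫ y, b y ∂μ := integral_nonneg fun y => b.nonneg
  have h1 : 0 < ∫ y, b y * -fourierDensity μ y := by
    refine Continuous.integral_pos_of_hasCompactSupport_nonneg_nonzero (x := x)
      (b.continuous.mul hc.neg) b.hasCompactSupport.mul_right (fun y => ?_) ?_
    · by_cases hy : y ∈ Metric.ball x δ
      · exact mul_nonneg b.nonneg (by linarith [hball y hy])
      · rw [b.zero_of_le_dist (by simpa using hy)]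
        simp
    · rw [b.one_of_mem_closedBall (Metric.mem_closedBall_self b.rIn_pos.le)]
      simpa using hx.ne
  simp only [mul_neg, integral_neg] at h1
  linarith

/-- Bumps equal to `1` on growing balls bound the integral of the nonnegative density over each ball
by the total mass of `μ`. -/
lemma integrable_fourierDensity {μ : Measure V} [IsFiniteMeasure μ]
    (h : Integrable (scaledCharFun μ)) (hc : Continuous (fourierDensity μ)) :
    Integrable (fourierDensity μ) := by
  have hcov : AECover (volume : Measure V) atTop
      (fun n : ℕ => Metric.closedBall (0 : V) (n + 1 : ℝ)) :=
    aecover_closedBall (tendsto_natCast_atTop_atTop.atTop_add tendsto_const_nhds)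
  refine hcov.integrable_of_integral_norm_bounded (μ.real Set.univ)
    (fun n => hc.continuousOn.integrableOn_compact (isCompact_closedBall _ _))
    (Eventually.of_forall fun n => ?_)
  let b : ContDiffBump (0 : V) := ⟨n + 1, n + 2, by positivity, by linarith⟩
  have hI : ∫ y, b y * fourierDensity μ y = ∫ y, b y ∂μ :=
    integral_mul_fourierDensity h b.contDiff b.hasCompactSupport
  have hint : Integrable (fun y => b y * fourierDensity μ y) :=
    (b.continuous.mul hc).integrable_of_hasCompactSupport b.hasCompactSupport.mul_right
  calc ∫ y in Metric.closedBall 0 (n + 1 : ℝ), ‖fourierDensity μ y‖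
      = ∫ y in Metric.closedBall 0 (n + 1 : ℝ), b y * fourierDensity μ y := by
        refine setIntegral_congr_fun Metric.isClosed_closedBall.measurableSet fun y hy => ?_
        simp only [b.one_of_mem_closedBall hy, one_mul]
        exact Real.norm_of_nonneg (fourierDensity_nonneg h hc y)
    _ ≤ ∫ y, b y * fourierDensity μ y :=
        setIntegral_le_integral hint
          (ae_of_all _ fun y => mul_nonneg b.nonneg (fourierDensity_nonneg h hc y))
    _ = ∫ y, b y ∂μ := hI
    _ ≤ ∫ y, (1 : ℝ) ∂μ :=
        integral_mono_of_nonneg (ae_of_all _ fun y => b.nonneg) (integrable_const _)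
          (ae_of_all _ fun y => b.le_one)
    _ = μ.real Set.univ := by simp

/-- With the density integrable, Fourier inversion holds pointwise and identifies the two
characteristic functions. -/
lemma eq_withDensity_fourierDensity {μ : Measure V} [IsFiniteMeasure μ]
    (h : Integrable (scaledCharFun μ)) (hc : Continuous (fourierDensity μ)) :
    μ = volume.withDensity (fun x => ENNReal.ofReal (fourierDensity μ x)) := by
  have hi := integrable_fourierDensity h hc
  have h0 := fourierDensity_nonneg h hc
  have : IsFiniteMeasure (volume.withDensity (fun x => ENNReal.ofReal (fourierDensity μ x))) :=
    isFiniteMeasure_withDensity_ofReal hi.2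
  have hF : Integrable (𝓕 (scaledCharFun μ)) :=
    hi.ofReal.congr (ae_of_all _ fun x => ofReal_fourierDensity μ x)
  refine Measure.ext_of_charFun (funext fun t => ?_)
  have hinv := congrFun ((continuous_scaledCharFun μ).fourierInv_fourier_eq h hF)
    ((2 * Real.pi)⁻¹ • t)
  rw [scaledCharFun, smul_smul, mul_inv_cancel₀ (by positivity), one_smul] at hinv
  rw [← hinv, charFun_apply, integral_withDensity_eq_integral_toReal_smul
    (by fun_prop) (ae_of_all _ fun _ => ENNReal.ofReal_lt_top), Real.fourierInv_eq']
  refine integral_congr_ae (ae_of_all _ fun x => ?_)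
  simp only [ENNReal.toReal_ofReal (h0 x), Complex.real_smul, ← ofReal_fourierDensity, smul_eq_mul,
    inner_smul_right]
  rw [mul_comm]
  congr 3
  push_cast
  field_simp

theorem exists_smooth_density {μ : Measure V} [IsFiniteMeasure μ]
    (h : ∀ n : ℕ, Integrable (fun z => ‖z‖ ^ n * ‖charFun μ z‖)) :
    μ ≪ volume ∧
      ∃ f : V → ℝ, (∀ x, 0 ≤ f x) ∧
        μ = volume.withDensity (fun x => ENNReal.ofReal (f x)) ∧
        ContDiff ℝ ∞ f ∧
        ∀ n : ℕ, Tendsto (iteratedFDeriv ℝ n f) (cocompact V) (𝓝 0) := by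
  have hi : Integrable (scaledCharFun μ) := by
    rw [← integrable_norm_iff (continuous_scaledCharFun μ).aestronglyMeasurable]
    simpa using integrable_pow_mul_scaledCharFun (h 0)
  have hc := contDiff_fourierDensity h
  have hd := eq_withDensity_fourierDensity hi hc.continuous
  refine ⟨?_, fourierDensity μ, fourierDensity_nonneg hi hc.continuous, hd, hc,
    tendsto_iteratedFDeriv_fourierDensity h⟩
  rw [hd]
  exact withDensity_absolutelyContinuous _ _

end Density

/-! ### Integrability under stretched-exponential decay -/

lemma integrable_pow_mul_of_exp_decay {V : Type*} [NormedAddCommGroup V] [InnerProductSpace ℝ V]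
    [FiniteDimensional ℝ V] [MeasurableSpace V] [BorelSpace V] {φ : V → ℂ} (hφ : Continuous φ)
    {c α : ℝ} (hc : 0 < c) (hα : 0 < α)
    (h : ∀ᶠ z in cocompact V, ‖φ z‖ ≤ Real.exp (-(c * ‖z‖ ^ α))) (n : ℕ) :
    Integrable (fun z => ‖z‖ ^ n * ‖φ z‖) := by
  set N : ℝ := Module.finrank ℝ V + 1
  refine LocallyIntegrable.integrable_of_isBigO_cocompact (g := fun z : V => (1 + ‖z‖) ^ (-N))
    (by fun_prop : Continuous fun z => ‖z‖ ^ n * ‖φ z‖).locallyIntegrable ?_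
    ((integrable_one_add_norm (lt_add_one _)).integrableAtFilter _)
  have ht : Tendsto (fun z : V => ‖z‖) (cocompact V) atTop := tendsto_norm_cocompact_atTop
  -- The exponent is chosen so that `(‖z‖ ^ α) ^ (-(n + N) / α) = ‖z‖ ^ (-(n + N))`.
  have h1 := ((isLittleO_exp_neg_mul_rpow_atTop hc (-(n + N) / α)).comp_tendsto
    ((tendsto_rpow_atTop hα).comp ht)).bound (one_pos)
  -- The constant comes from `1 + ‖z‖ ≤ 2 * ‖z‖` for `‖z‖ ≥ 1`.
  refine Asymptotics.IsBigO.of_bound (2 ^ N) ?_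
  filter_upwards [h, h1, ht.eventually_ge_atTop 1] with z hz hz1 hz2
  have hz0 : 0 < ‖z‖ := by linarith
  simp only [Function.comp, Real.norm_eq_abs, Real.abs_exp, one_mul] at hz1
  rw [abs_of_nonneg (by positivity), ← Real.rpow_mul hz0.le, mul_div_cancel₀ _ hα.ne',
    neg_mul] at hz1
  rw [Real.norm_of_nonneg (by positivity), Real.norm_of_nonneg (by positivity)]
  calc ‖z‖ ^ n * ‖φ z‖ ≤ ‖z‖ ^ (n : ℝ) * ‖z‖ ^ (-(n + N)) := by
        rw [Real.rpow_natCast]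
        gcongr
        exact hz.trans hz1
    _ = ‖z‖ ^ (-N) := by
        rw [← Real.rpow_add hz0]
        congr 1
        ring
    _ = 2 ^ N * (2 * ‖z‖) ^ (-N) := by
        rw [Real.mul_rpow (by norm_num) hz0.le, ← mul_assoc, ← Real.rpow_add (by norm_num)]
        simp
    _ ≤ 2 ^ N * (1 + ‖z‖) ^ (-N) := by
        refine mul_le_mul_of_nonneg_left ?_ (by positivity)
        exact Real.rpow_le_rpow_of_nonpos (by positivity) (by linarith)
          (by simp only [N]; rw [neg_nonpos]; positivity)

variable {d : ℕ}

/-! ### Integrals of the Lévy kernel -/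

/-- `∫ (1 - cos⟨z,x⟩) m(dx)`. -/
noncomputable def cosIntegral (m : Measure (E d)) (z : E d) : ℝ :=
  ∫ x, (1 - Real.cos (inner ℝ z x)) ∂m

/-- `∫ min(1, R²|x|²) m(dx)`. -/
noncomputable def truncIntegral (m : Measure (E d)) (R : ℝ) : ℝ :=
  ∫ x, min 1 ((R * ‖x‖) ^ 2) ∂m

lemma integrable_of_norm_le_min {m : Measure (E d)}
    (hm : Integrable (fun x => min (1 : ℝ) (‖x‖ ^ 2)) m) {F : Type*} [NormedAddCommGroup F]
    {f : E d → F} (hf : AEStronglyMeasurable f m) {C : ℝ}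
    (h : ∀ x, ‖f x‖ ≤ C * min 1 (‖x‖ ^ 2)) : Integrable f m :=
  (hm.const_mul C).mono' hf (ae_of_all _ h)

lemma min_one_mul_le {R u : ℝ} (hR : 0 ≤ R) (hu : 0 ≤ u) :
    min 1 (R * u) ≤ (1 + R) * min 1 u := by
  rcases le_total 1 u with h | h
  · rw [min_eq_left h]
    linarith [min_le_left 1 (R * u)]
  · rw [min_eq_right h]
    nlinarith [min_le_right 1 (R * u)]

lemma integrable_truncIntegrand {m : Measure (E d)}
    (hm : Integrable (fun x => min (1 : ℝ) (‖x‖ ^ 2)) m) (R : ℝ) :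
    Integrable (fun x : E d => min 1 ((R * ‖x‖) ^ 2)) m := by
  refine integrable_of_norm_le_min hm (by fun_prop) (C := 1 + R ^ 2) fun x => ?_
  rw [Real.norm_of_nonneg (le_min zero_le_one (sq_nonneg _)), mul_pow]
  exact min_one_mul_le (sq_nonneg _) (sq_nonneg _)

lemma one_sub_cos_le_two_mul_min (u : ℝ) : 1 - Real.cos u ≤ 2 * min 1 (u ^ 2) := by
  have h1 := Real.neg_one_le_cos u
  have h2 := Real.one_sub_sq_div_two_le_cos (x := u)
  rcases le_total 1 (u ^ 2) with h | h
  · rw [min_eq_left h]; linarith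
  · rw [min_eq_right h]; nlinarith [sq_nonneg u]

lemma sq_inner_le (z x : E d) : (inner ℝ z x) ^ 2 ≤ (‖z‖ * ‖x‖) ^ 2 := by
  rw [← sq_abs]
  gcongr
  exact abs_real_inner_le_norm z x

lemma one_sub_cos_inner_le (z x : E d) :
    1 - Real.cos (inner ℝ z x) ≤ 2 * min 1 ((‖z‖ * ‖x‖) ^ 2) :=
  (one_sub_cos_le_two_mul_min _).trans 
    (mul_le_mul_of_nonneg_left (min_le_min_left 1 (sq_inner_le z x)) zero_le_two)

lemma integrable_one_sub_cos {m : Measure (E d)}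
    (hm : Integrable (fun x => min (1 : ℝ) (‖x‖ ^ 2)) m) (z : E d) :
    Integrable (fun x => 1 - Real.cos (inner ℝ z x)) m := by
  refine ((integrable_truncIntegrand hm ‖z‖).const_mul 2).mono' (by fun_prop)
    (ae_of_all _ fun x => ?_)
  rw [Real.norm_of_nonneg (by linarith [Real.cos_le_one (inner ℝ z x)])]
  exact one_sub_cos_inner_le z x

lemma cosIntegral_nonneg (m : Measure (E d)) (z : E d) : 0 ≤ cosIntegral m z :=
  integral_nonneg fun x => by
    simp only [Pi.zero_apply]
    linarith [Real.cos_le_one (inner ℝ z x)]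

lemma cosIntegral_le {m : Measure (E d)}
    (hm : Integrable (fun x => min (1 : ℝ) (‖x‖ ^ 2)) m) (z : E d) :
    cosIntegral m z ≤ 2 * truncIntegral m ‖z‖ := by
  rw [cosIntegral, truncIntegral, ← integral_const_mul]
  exact integral_mono (integrable_one_sub_cos hm z) ((integrable_truncIntegrand hm _).const_mul 2)
    fun x => one_sub_cos_inner_le z x

lemma truncIntegral_mono {m : Measure (E d)}
    (hm : Integrable (fun x => min (1 : ℝ) (‖x‖ ^ 2)) m) {R S : ℝ} (hR : 0 ≤ R) (h : R ≤ S) :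
    truncIntegral m R ≤ truncIntegral m S :=
  integral_mono (integrable_truncIntegrand hm _) (integrable_truncIntegrand hm _) fun x => by
    dsimp only
    gcongr

/-- Dominated convergence: the integrand is at most `1 / R ^ 2`, and for `R ≥ 1` at most `min 1 (‖x‖
^ 2)`. -/
lemma tendsto_truncIntegral_div_sq {m : Measure (E d)}
    (hm : Integrable (fun x => min (1 : ℝ) (‖x‖ ^ 2)) m) :
    Tendsto (fun R : ℝ => truncIntegral m R / R ^ 2) atTop (𝓝 0) := by
  have h : Tendsto (fun R : ℝ => ∫ x : E d, min 1 ((R * ‖x‖) ^ 2) / R ^ 2 ∂m) atTop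
      (𝓝 (∫ x : E d, (0 : ℝ) ∂m)) := by
    refine tendsto_integral_filter_of_dominated_convergence (fun x => min (1 : ℝ) (‖x‖ ^ 2))
      (Eventually.of_forall fun R => by fun_prop) ?_ hm (ae_of_all _ fun x => ?_)
    · filter_upwards [eventually_ge_atTop 1] with R hR
      refine ae_of_all _ fun x => ?_
      have hR2 : 1 ≤ R ^ 2 := one_le_pow₀ hR
      rw [Real.norm_of_nonneg (by positivity), div_le_iff₀ (by positivity)]
      rw [min_mul_of_nonneg _ _ (by positivity)]
      refine min_le_min (by linarith) (by rw [mul_pow, mul_comm])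
    · have h2 : Tendsto (fun R : ℝ => 1 / R ^ 2) atTop (𝓝 0) :=
        tendsto_const_nhds.div_atTop (tendsto_pow_atTop two_ne_zero)
      refine squeeze_zero (fun R => by positivity) (fun R => ?_) h2
      gcongr
      exact min_le_left _ _
  simp only [integral_div, integral_zero] at h
  exact h

lemma tendsto_cosIntegral_div_sq {m : Measure (E d)}
    (hm : Integrable (fun x => min (1 : ℝ) (‖x‖ ^ 2)) m) :
    Tendsto (fun z => cosIntegral m z / ‖z‖ ^ 2) (cocompact (E d)) (𝓝 0) := by
  have h := ((tendsto_truncIntegral_div_sq hm).comp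
    (tendsto_norm_cocompact_atTop (E := E d))).const_mul 2
  rw [mul_zero] at h
  refine squeeze_zero (fun z => div_nonneg (cosIntegral_nonneg m z) (sq_nonneg _)) (fun z => ?_) h
  rw [Function.comp, ← mul_div_assoc]
  gcongr
  exact cosIntegral_le hm z

lemma measurable_stdRepr : Measurable (stdRepr : E d → E d) :=
  measurable_id.indicator (measurableSet_le measurable_norm measurable_const)

lemma measurable_levyKernel (z : E d) : Measurable (levyKernel z) := by
  have := measurable_stdRepr (d := d)
  unfold levyKernel
  fun_prop

lemma norm_exp_I_mul_sub_one_sub_le (u : ℝ) :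
    ‖Complex.exp (Complex.I * u) - 1 - Complex.I * u‖ ≤ 3 * u ^ 2 := by
  rcases le_total |u| 1 with h | h
  · have h1 : ‖Complex.I * (u : ℂ)‖ ≤ 1 := by simpa using h
    refine (Complex.norm_exp_sub_one_sub_id_le h1).trans ?_
    simp only [norm_mul, Complex.norm_I, one_mul, Complex.norm_real, Real.norm_eq_abs, sq_abs]
    nlinarith [sq_nonneg u]
  · have h1 : ‖Complex.exp (Complex.I * u) - 1‖ ≤ |u| := Real.norm_exp_I_mul_ofReal_sub_one_le
    have h2 : ‖Complex.I * (u : ℂ)‖ = |u| := by simp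
    have h3 := norm_sub_le (Complex.exp (Complex.I * u) - 1) (Complex.I * u)
    rw [← sq_abs]
    nlinarith

lemma norm_levyKernel_le (z x : E d) :
    ‖levyKernel z x‖ ≤ (2 + 3 * ‖z‖ ^ 2) * min 1 (‖x‖ ^ 2) := by
  unfold levyKernel
  rcases le_or_gt ‖x‖ 1 with h | h
  · have hs : stdRepr x = x := Set.indicator_of_mem (s := {y : E d | ‖y‖ ≤ 1}) h id
    rw [hs, min_eq_right (pow_le_one₀ (norm_nonneg x) h)]
    refine (norm_exp_I_mul_sub_one_sub_le _).trans ?_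
    have := sq_inner_le z x
    rw [mul_pow] at this
    nlinarith [sq_nonneg ‖x‖]
  · have hs : stdRepr x = 0 :=
      Set.indicator_of_notMem (s := {y : E d | ‖y‖ ≤ 1}) (not_le.2 h) id
    rw [hs, min_eq_left (one_le_pow₀ h.le)]
    have h3 := norm_sub_le (Complex.exp (Complex.I * (inner ℝ z x : ℝ))) 1
    rw [mul_comm Complex.I, Complex.norm_exp_ofReal_mul_I] at h3
    simp only [inner_zero_right, Complex.ofReal_zero, mul_zero, sub_zero, mul_one]
    rw [mul_comm Complex.I]
    simp only [norm_one] at h3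
    nlinarith [sq_nonneg ‖z‖]

lemma integrable_levyKernel {m : Measure (E d)}
    (hm : Integrable (fun x => min (1 : ℝ) (‖x‖ ^ 2)) m) (z : E d) :
    Integrable (levyKernel z) m :=
  integrable_of_norm_le_min hm (measurable_levyKernel z).aestronglyMeasurable (norm_levyKernel_le z)

lemma re_levyKernel (z x : E d) : (levyKernel z x).re = -(1 - Real.cos (inner ℝ z x)) := by
  rw [levyKernel, mul_comm Complex.I, mul_comm Complex.I]
  simp [Complex.exp_ofReal_mul_I_re]

lemma re_integral_levyKernel {m : Measure (E d)}
    (hm : Integrable (fun x => min (1 : ℝ) (‖x‖ ^ 2)) m) (z : E d) :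
    (∫ x, levyKernel z x ∂m).re = -cosIntegral m z := by
  have := integral_re (integrable_levyKernel hm z)
  simp only [RCLike.re_eq_complex_re] at this
  rw [← this, cosIntegral, ← integral_neg]
  simp only [re_levyKernel]

lemma HasCharTriplet.norm_charFun {μ : Measure (E d)} {A : Matrix (Fin d) (Fin d) ℝ}
    {ν : LocalSignedMeasure d} {γ : E d} (h : HasCharTriplet μ A ν γ) (z : E d) :
    ‖charFun μ z‖ = Real.exp (-(1 / 2) * (z.ofLp ⬝ᵥ A.mulVec z.ofLp)
      - cosIntegral ν.posPart z + cosIntegral ν.negPart z) := by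
  rw [h.2.2 z, Complex.norm_exp]
  congr 1
  rw [charExponent, LocalSignedMeasure.integral, Complex.add_re, Complex.sub_re, Complex.sub_re,
    re_integral_levyKernel h.2.1.1, re_integral_levyKernel h.2.1.2]
  have h1 : ((1 / 2 : ℂ) * ((z.ofLp ⬝ᵥ A.mulVec z.ofLp : ℝ) : ℂ)).re
      = 1 / 2 * (z.ofLp ⬝ᵥ A.mulVec z.ofLp) := by
    rw [Complex.re_mul_ofReal]; norm_num
  rw [h1]
  simp only [Complex.mul_re, Complex.I_re, Complex.I_im, Complex.ofReal_re, Complex.ofReal_im]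
  ring

/-- The Gaussian part of a characteristic triplet of a probability distribution is positive
semidefinite, even if the Lévy measure is signed. -/
lemma HasCharTriplet.quadForm_nonneg {μ : Measure (E d)} [IsProbabilityMeasure μ]
    {A : Matrix (Fin d) (Fin d) ℝ} {ν : LocalSignedMeasure d} {γ : E d}
    (h : HasCharTriplet μ A ν γ) (z : E d) : 0 ≤ z.ofLp ⬝ᵥ A.mulVec z.ofLp := by
  rcases eq_or_ne z 0 with rfl | hz
  · simp
  have hz0 : 0 < ‖z‖ := norm_pos_iff.2 hz
  have ht : Tendsto (fun t : ℝ => t * ‖z‖) atTop atTop := tendsto_id.atTop_mul_const hz0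
  -- From `|μ̂(tz)| ≤ 1`, the form `t²⟨z,Az⟩` is at least `-2` times the cosine integral of `ν⁺`,
  -- hence at least `-4` times its truncated integral, which is `o(t²)`.
  have h1 := (((tendsto_truncIntegral_div_sq h.2.1.1).comp ht).const_mul (4 * ‖z‖ ^ 2)).add_const
    (z.ofLp ⬝ᵥ A.mulVec z.ofLp)
  rw [mul_zero, zero_add] at h1
  refine ge_of_tendsto h1 ?_
  filter_upwards [eventually_gt_atTop 0] with t ht0
  have hle : ‖charFun μ (t • z)‖ ≤ 1 := norm_charFun_le_one _
  rw [h.norm_charFun, Real.exp_le_one_iff] at hle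
  have hneg := cosIntegral_nonneg ν.negPart (t • z)
  have hpos := cosIntegral_le h.2.1.1 (t • z)
  rw [norm_smul, Real.norm_of_nonneg ht0.le] at hpos
  have hq : (t • z).ofLp ⬝ᵥ A.mulVec (t • z).ofLp = t ^ 2 * (z.ofLp ⬝ᵥ A.mulVec z.ofLp) := by
    rw [WithLp.ofLp_smul, Matrix.mulVec_smul, smul_dotProduct, dotProduct_smul]
    simp only [smul_eq_mul]
    ring
  rw [hq] at hle
  have he : 4 * ‖z‖ ^ 2 * (truncIntegral ν.posPart (t * ‖z‖) / (t * ‖z‖) ^ 2)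
      + z.ofLp ⬝ᵥ A.mulVec z.ofLp
      = (4 * truncIntegral ν.posPart (t * ‖z‖) + t ^ 2 * (z.ofLp ⬝ᵥ A.mulVec z.ofLp)) / t ^ 2 := by
    field_simp
  simp only [Function.comp]
  rw [he]
  exact div_nonneg (by linarith) (sq_nonneg t)

/-! ### Decay of the characteristic function: nondegenerate Gaussian part -/

lemma exists_quadForm_lower_bound {A : Matrix (Fin d) (Fin d) ℝ} (hA : A.PosDef) :
    ∃ c : ℝ, 0 < c ∧ ∀ z : E d, c * ‖z‖ ^ 2 ≤ z.ofLp ⬝ᵥ A.mulVec z.ofLp := by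
  have hcont : Continuous fun z : E d => z.ofLp ⬝ᵥ A.mulVec z.ofLp := by
    have h1 : Continuous fun z : E d => z.ofLp := PiLp.continuous_ofLp 2 _
    exact h1.dotProduct (continuous_const.matrix_mulVec h1)
  -- This form of the minimum principle also covers the empty sphere of dimension `0`.
  obtain ⟨c, hc, h⟩ := (isCompact_sphere (0 : E d) 1).exists_forall_le' hcont.continuousOn
    (a := 0) fun z hz => by
      have hz0 : z.ofLp ≠ 0 := by
        intro h0
        have : z = 0 := (WithLp.ofLp_eq_zero 2).1 h0
        simp [this] at hz
      simpa using hA.dotProduct_mulVec_pos hz0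
  refine ⟨c, hc, fun z => ?_⟩
  rcases eq_or_ne z 0 with rfl | hz
  · simp
  have hz0 : ‖z‖ ≠ 0 := norm_ne_zero_iff.2 hz
  have := h (‖z‖⁻¹ • z) (by simp [norm_smul, hz0])
  rw [WithLp.ofLp_smul, Matrix.mulVec_smul, smul_dotProduct, dotProduct_smul] at this
  simp only [smul_eq_mul] at this
  calc c * ‖z‖ ^ 2 ≤ (‖z‖⁻¹ * (‖z‖⁻¹ * (z.ofLp ⬝ᵥ A.mulVec z.ofLp))) * ‖z‖ ^ 2 := by gcongr
    _ = z.ofLp ⬝ᵥ A.mulVec z.ofLp := by field_simp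

theorem HasCharTriplet.exp_decay_of_posDef {μ : Measure (E d)}
    {A : Matrix (Fin d) (Fin d) ℝ} {ν : LocalSignedMeasure d} {γ : E d}
    (h : HasCharTriplet μ A ν γ) (hA : A.PosDef) :
    ∃ c : ℝ, 0 < c ∧
      ∀ᶠ z in cocompact (E d), ‖charFun μ z‖ ≤ Real.exp (-(c * ‖z‖ ^ (2 : ℝ))) := by
  obtain ⟨c, hc, hq⟩ := exists_quadForm_lower_bound hA
  -- The Gaussian term supplies `c / 2`, of which the `ν⁻` term eventually consumes at most `c / 4`.
  refine ⟨c / 4, by positivity, ?_⟩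
  filter_upwards [(tendsto_cosIntegral_div_sq h.2.1.2).eventually_le_const
    (show (0 : ℝ) < c / 4 by positivity),
    (tendsto_norm_cocompact_atTop (E := E d)).eventually_gt_atTop 0] with z hz hz0
  rw [h.norm_charFun, Real.exp_le_exp, Real.rpow_two]
  rw [div_le_iff₀ (by positivity)] at hz
  linarith [hq z, cosIntegral_nonneg ν.posPart z]

/-! ### Decay of the characteristic function: the Orey-type condition -/

lemma integrableOn_of_norm_le_sq {m : Measure (E d)}
    (hm : Integrable (fun x => min (1 : ℝ) (‖x‖ ^ 2)) m) {r : ℝ} (hr : r ≤ 1)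
    {f : E d → ℝ} (hf : Continuous f) {C : ℝ} (h : ∀ x, |f x| ≤ C * ‖x‖ ^ 2) :
    IntegrableOn f {x : E d | ‖x‖ ≤ r} m := by
  refine (hm.const_mul C).integrableOn.mono' hf.aestronglyMeasurable ?_
  refine (ae_restrict_mem (measurableSet_le measurable_norm measurable_const)).mono fun x hx => ?_
  have hx1 : ‖x‖ ≤ 1 := le_trans hx hr
  rw [min_eq_right (pow_le_one₀ (norm_nonneg x) hx1)]
  exact h x

lemma integrableOn_mul_apply {m : Measure (E d)}
    (hm : Integrable (fun x => min (1 : ℝ) (‖x‖ ^ 2)) m) {r : ℝ} (hr : r ≤ 1) (i j : Fin d) :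
    IntegrableOn (fun x : E d => x i * x j) {x : E d | ‖x‖ ≤ r} m := by
  refine integrableOn_of_norm_le_sq hm hr (by fun_prop) (C := 1) fun x => ?_
  rw [abs_mul, one_mul, sq]
  exact mul_le_mul (PiLp.norm_apply_le x i) (PiLp.norm_apply_le x j) (abs_nonneg _) (norm_nonneg _)

lemma integrableOn_sq_inner {m : Measure (E d)}
    (hm : Integrable (fun x => min (1 : ℝ) (‖x‖ ^ 2)) m) {r : ℝ} (hr : r ≤ 1) (z : E d) :
    IntegrableOn (fun x : E d => (inner ℝ z x) ^ 2) {x : E d | ‖x‖ ≤ r} m := by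
  refine integrableOn_of_norm_le_sq hm hr (by fun_prop) (C := ‖z‖ ^ 2) fun x => ?_
  rw [abs_of_nonneg (sq_nonneg _), ← mul_pow]
  exact sq_inner_le z x

/-- The bound `r ≤ 1` puts the ball where `min 1 (‖x‖ ^ 2) = ‖x‖ ^ 2`, so all entries of the matrix
are genuine integrals. -/
lemma quadForm_truncMoment {m : Measure (E d)}
    (hm : Integrable (fun x => min (1 : ℝ) (‖x‖ ^ 2)) m) {r : ℝ} (hr : r ≤ 1) (z : E d) :
    z.ofLp ⬝ᵥ (truncMoment m r).mulVec z.ofLp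
      = ∫ x in {x : E d | ‖x‖ ≤ r}, (inner ℝ z x) ^ 2 ∂m := by
  have h : ∀ x : E d, (inner ℝ z x) ^ 2 = ∑ i, ∑ j, z i * z j * (x i * x j) := fun x => by
    rw [PiLp.inner_apply, sq, Finset.sum_mul_sum]
    refine Finset.sum_congr rfl fun i _ => Finset.sum_congr rfl fun j _ => ?_
    simp only [RCLike.inner_apply, conj_trivial]
    ring
  simp only [h]
  rw [integral_finsetSum _ fun i _ => integrable_finsetSum _ fun j _ =>
    (integrableOn_mul_apply hm hr i j).const_mul _]
  simp only [dotProduct, Matrix.mulVec, truncMoment, Matrix.of_apply]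
  refine Finset.sum_congr rfl fun i _ => ?_
  rw [integral_finsetSum _ fun j _ => (integrableOn_mul_apply hm hr i j).const_mul _,
    Finset.mul_sum]
  refine Finset.sum_congr rfl fun j _ => ?_
  rw [integral_const_mul]
  ring

lemma setIntegral_sq_inner_le {m : Measure (E d)}
    (hm : Integrable (fun x => min (1 : ℝ) (‖x‖ ^ 2)) m) {r : ℝ} (hr : r ≤ 1) (z : E d) :
    ∫ x in {x : E d | ‖x‖ ≤ r}, (inner ℝ z x) ^ 2 ∂m
      ≤ ‖z‖ ^ 2 * ∫ x in {x : E d | ‖x‖ ≤ r}, ‖x‖ ^ 2 ∂m := by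
  rw [← integral_const_mul]
  refine integral_mono (integrableOn_sq_inner hm hr z)
    ((integrableOn_of_norm_le_sq hm hr (by fun_prop) (C := 1) fun x => ?_).const_mul _) fun x => ?_
  · rw [abs_of_nonneg (sq_nonneg _), one_mul]
  · simp only [← mul_pow]
    exact sq_inner_le z x

/-- The left side is the trace of the truncated moment matrix, a sum of `d` diagonal entries each at
most the supremum of the quadratic form. -/
lemma setIntegral_sq_norm_le_GMinus {ν : LocalSignedMeasure d}
    (hm : Integrable (fun x => min (1 : ℝ) (‖x‖ ^ 2)) ν.negPart) {r : ℝ} (hr : r ≤ 1) :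
    ∫ x in {x : E d | ‖x‖ ≤ r}, ‖x‖ ^ 2 ∂ν.negPart ≤ d * GMinus ν r := by
  -- A real supremum dominates its terms only once boundedness is known; otherwise it defaults to
  -- `0`.
  have hbdd : BddAbove (Set.range fun ξ : Metric.sphere (0 : E d) 1 =>
      (ξ : E d).ofLp ⬝ᵥ (truncMoment ν.negPart r).mulVec (ξ : E d).ofLp) := by
    refine ⟨∫ x in {x : E d | ‖x‖ ≤ r}, ‖x‖ ^ 2 ∂ν.negPart, ?_⟩
    rintro _ ⟨ξ, rfl⟩
    dsimp only
    rw [quadForm_truncMoment hm hr]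
    refine (setIntegral_sq_inner_le hm hr _).trans_eq ?_
    rw [mem_sphere_zero_iff_norm.1 ξ.2]
    ring
  have h : ∀ x : E d, ‖x‖ ^ 2 = ∑ i, (inner ℝ (EuclideanSpace.single i (1 : ℝ)) x) ^ 2 := by
    intro x
    rw [EuclideanSpace.norm_sq_eq]
    simp [EuclideanSpace.inner_single_left]
  simp only [h]
  rw [integral_finsetSum _ fun i _ => integrableOn_sq_inner hm hr _]
  calc ∑ i, ∫ x in {x : E d | ‖x‖ ≤ r},
        (inner ℝ (EuclideanSpace.single i (1 : ℝ)) x) ^ 2 ∂ν.negPart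
      ≤ ∑ _i : Fin d, GMinus ν r := Finset.sum_le_sum fun i _ => by
        rw [← quadForm_truncMoment hm hr]
        exact le_ciSup hbdd ⟨EuclideanSpace.single i (1 : ℝ), by simp⟩
    _ = d * GMinus ν r := by simp

lemma sq_norm_mul_GPlus_le {ν : LocalSignedMeasure d}
    (hm : Integrable (fun x => min (1 : ℝ) (‖x‖ ^ 2)) ν.posPart) {r : ℝ} (hr : r ≤ 1) {z : E d}
    (hz : z ≠ 0) :
    ‖z‖ ^ 2 * GPlus ν r ≤ ∫ x in {x : E d | ‖x‖ ≤ r}, (inner ℝ z x) ^ 2 ∂ν.posPart := by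
  have hbdd : BddBelow (Set.range fun ξ : Metric.sphere (0 : E d) 1 =>
      (ξ : E d).ofLp ⬝ᵥ (truncMoment ν.posPart r).mulVec (ξ : E d).ofLp) := by
    refine ⟨0, ?_⟩
    rintro _ ⟨ξ, rfl⟩
    dsimp only
    rw [quadForm_truncMoment hm hr]
    exact integral_nonneg fun x => sq_nonneg _
  have hz0 : ‖z‖ ≠ 0 := norm_ne_zero_iff.2 hz
  have h := ciInf_le hbdd ⟨‖z‖⁻¹ • z, by simp [norm_smul, hz0]⟩
  dsimp only at h
  rw [quadForm_truncMoment hm hr] at h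
  simp only [real_inner_smul_left, mul_pow] at h
  rw [integral_const_mul] at h
  calc ‖z‖ ^ 2 * GPlus ν r
      ≤ ‖z‖ ^ 2 * (‖z‖⁻¹ ^ 2 * ∫ x in {x : E d | ‖x‖ ≤ r}, (inner ℝ z x) ^ 2 ∂ν.posPart) :=
        mul_le_mul_of_nonneg_left h (sq_nonneg _)
    _ = _ := by field_simp

/-- On the ball of radius `‖z‖⁻¹` one has `|⟨z,x⟩| ≤ 1`, where `1 - cos u ≥ 2u²/π²`; the rest of the
nonnegative integrand is dropped. -/
lemma sq_norm_mul_GPlus_le_cosIntegral {ν : LocalSignedMeasure d}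
    (hm : Integrable (fun x => min (1 : ℝ) (‖x‖ ^ 2)) ν.posPart) {z : E d} (hz : 1 ≤ ‖z‖) :
    2 / Real.pi ^ 2 * (‖z‖ ^ 2 * GPlus ν ‖z‖⁻¹) ≤ cosIntegral ν.posPart z := by
  have hz0 : z ≠ 0 := norm_pos_iff.1 (by linarith)
  have hr : ‖z‖⁻¹ ≤ 1 := inv_le_one_of_one_le₀ hz
  calc 2 / Real.pi ^ 2 * (‖z‖ ^ 2 * GPlus ν ‖z‖⁻¹)
      ≤ 2 / Real.pi ^ 2 * ∫ x in {x : E d | ‖x‖ ≤ ‖z‖⁻¹}, (inner ℝ z x) ^ 2 ∂ν.posPart := by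
        gcongr
        exact sq_norm_mul_GPlus_le hm hr hz0
    _ = ∫ x in {x : E d | ‖x‖ ≤ ‖z‖⁻¹}, 2 / Real.pi ^ 2 * (inner ℝ z x) ^ 2 ∂ν.posPart :=
        (integral_const_mul _ _).symm
    _ ≤ ∫ x in {x : E d | ‖x‖ ≤ ‖z‖⁻¹}, (1 - Real.cos (inner ℝ z x)) ∂ν.posPart := by
        refine setIntegral_mono_on ((integrableOn_sq_inner hm hr z).const_mul _)
          (integrable_one_sub_cos hm z).integrableOn
          (measurableSet_le measurable_norm measurable_const) fun x hx => ?_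
        have h1 : |inner ℝ z x| ≤ 1 := by
          refine (abs_real_inner_le_norm z x).trans ?_
          calc ‖z‖ * ‖x‖ ≤ ‖z‖ * ‖z‖⁻¹ := by gcongr; exact hx
            _ = 1 := mul_inv_cancel₀ (norm_ne_zero_iff.2 hz0)
        have := Real.cos_le_one_sub_mul_cos_sq (h1.trans (by linarith [Real.pi_gt_three]))
        linarith
    _ ≤ cosIntegral ν.posPart z :=
        setIntegral_le_integral (integrable_one_sub_cos hm z)
          (ae_of_all _ fun x => by simp [Real.cos_le_one])

/-- For `‖x‖ > 2 / R` both truncated integrands equal `1`, so passing from `R / 2` to `R` costs only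
small jumps. -/
lemma truncIntegral_le_half {m : Measure (E d)}
    (hm : Integrable (fun x => min (1 : ℝ) (‖x‖ ^ 2)) m) {R : ℝ} (hR : 2 ≤ R) :
    truncIntegral m R
      ≤ truncIntegral m (R / 2) + R ^ 2 * ∫ x in {x : E d | ‖x‖ ≤ 2 / R}, ‖x‖ ^ 2 ∂m := by
  have hR0 : 0 < R := by linarith
  have hS : MeasurableSet {x : E d | ‖x‖ ≤ 2 / R} :=
    measurableSet_le measurable_norm measurable_const
  have hi : IntegrableOn (fun x : E d => ‖x‖ ^ 2) {x : E d | ‖x‖ ≤ 2 / R} m :=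
    integrableOn_of_norm_le_sq hm (by rw [div_le_one hR0]; exact hR) (by fun_prop) (C := 1)
      fun x => by rw [abs_of_nonneg (sq_nonneg _), one_mul]
  rw [← integral_indicator hS, ← integral_const_mul, truncIntegral, truncIntegral, ← integral_add
    (integrable_truncIntegrand hm _) ((hi.integrable_indicator hS).const_mul _)]
  refine integral_mono (integrable_truncIntegrand hm _) ((integrable_truncIntegrand hm _).add
    ((hi.integrable_indicator hS).const_mul _)) fun x => ?_
  dsimp only
  by_cases hx : ‖x‖ ≤ 2 / R
  · rw [Set.indicator_of_mem (s := {x : E d | ‖x‖ ≤ 2 / R}) hx, ← mul_pow]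
    have : (0 : ℝ) ≤ min 1 ((R / 2 * ‖x‖) ^ 2) := by positivity
    linarith [min_le_right 1 ((R * ‖x‖) ^ 2)]
  · rw [Set.indicator_of_notMem (s := {x : E d | ‖x‖ ≤ 2 / R}) hx, mul_zero, add_zero]
    rw [not_le, div_lt_iff₀ hR0] at hx
    rw [min_eq_left (a := (1 : ℝ)) (b := (R / 2 * ‖x‖) ^ 2)
      (one_le_pow₀ (by linarith))]
    exact min_le_left _ _

/-- Halving `R` until it falls below `R₀` accumulates errors `ε (R / 2^k)^α`, a geometric series of
ratio `2^(-α)`. -/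
lemma le_add_mul_rpow_of_le_half {H : ℝ → ℝ} {R₀ ε α : ℝ} (hα : 0 < α) (hR₀ : 0 < R₀)
    (hε : 0 ≤ ε) (hmono : ∀ R, 0 ≤ R → R ≤ R₀ → H R ≤ H R₀)
    (h : ∀ R, R₀ ≤ R → H R ≤ H (R / 2) + ε * R ^ α) {R : ℝ} (hR : 0 ≤ R) :
    H R ≤ H R₀ + ε / (1 - 2 ^ (-α)) * R ^ α := by
  have hq : (2 : ℝ) ^ (-α) < 1 := Real.rpow_lt_one_of_one_lt_of_neg one_lt_two (by linarith)
  have hq' : 0 < 1 - (2 : ℝ) ^ (-α) := by linarith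
  have key : ∀ n : ℕ, ∀ R : ℝ, 0 ≤ R → R ≤ 2 ^ n * R₀ →
      H R ≤ H R₀ + ε / (1 - 2 ^ (-α)) * R ^ α := by
    intro n
    induction n with
    | zero =>
      intro R hR hle
      have := hmono R hR (by simpa using hle)
      have : 0 ≤ ε / (1 - 2 ^ (-α)) * R ^ α := by positivity
      linarith
    | succ n ih =>
      intro R hR hle
      rcases le_total R R₀ with h1 | h1
      · have := hmono R hR h1
        have : 0 ≤ ε / (1 - 2 ^ (-α)) * R ^ α := by positivity
        linarith
      · have h2 := ih (R / 2) (by positivity) (by rw [pow_succ] at hle; linarith)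
        have h3 := h R h1
        have h4 : (R / 2) ^ α = 2 ^ (-α) * R ^ α := by
          rw [Real.div_rpow hR zero_le_two, Real.rpow_neg zero_le_two, div_eq_inv_mul]
        rw [h4] at h2
        have h5 : ε / (1 - 2 ^ (-α)) * (2 ^ (-α) * R ^ α) + ε * R ^ α
            = ε / (1 - 2 ^ (-α)) * R ^ α := by
          field_simp
          ring
        linarith
  obtain ⟨n, hn⟩ := pow_unbounded_of_one_lt (R / R₀) one_lt_two
  exact key n R hR (by rw [div_lt_iff₀ hR₀] at hn; exact hn.le)

lemma eventually_truncIntegral_negPart_le {ν : LocalSignedMeasure d}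
    (hm : Integrable (fun x => min (1 : ℝ) (‖x‖ ^ 2)) ν.negPart) {β : ℝ} (hβ : β < 2)
    (h : ∀ ε : ℝ, 0 < ε → ∀ᶠ r in 𝓝[>] (0 : ℝ), GMinus ν r ≤ ε * r ^ β) {ε : ℝ} (hε : 0 < ε) :
    ∀ᶠ R : ℝ in atTop, truncIntegral ν.negPart R ≤ ε * R ^ (2 - β) := by
  have hα : 0 < 2 - β := by linarith
  have hq : (2 : ℝ) ^ (-(2 - β)) < 1 := Real.rpow_lt_one_of_one_lt_of_neg one_lt_two (by linarith)
  have hq' : 0 < 1 - (2 : ℝ) ^ (-(2 - β)) := by linarith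
  set q : ℝ := 1 - (2 : ℝ) ^ (-(2 - β))
  -- With this bound on `G⁻` at `r = 2 / R`, one halving costs at most `(ε q / 2) R^(2-β)`, and the
  -- geometric series divides by `q`. The other `ε / 2` absorbs the constant term at `R₀`; `d + 1`
  -- avoids division by zero for `d = 0`.
  have hδ : 0 < ε * q / (2 * (d + 1) * 2 ^ β) := by positivity
  have hlim : Tendsto (fun R : ℝ => 2 / R) atTop (𝓝[>] 0) := by
    refine tendsto_nhdsWithin_iff.2 ⟨tendsto_const_nhds.div_atTop tendsto_id, ?_⟩
    filter_upwards [eventually_gt_atTop 0] with R hR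
    exact div_pos two_pos hR
  obtain ⟨R₁, hR₁⟩ := eventually_atTop.1 (hlim.eventually (h _ hδ))
  set R₀ := max R₁ 2
  have hR₀ : 2 ≤ R₀ := le_max_right _ _
  have hb : ∀ R : ℝ, 0 ≤ R → truncIntegral ν.negPart R
      ≤ truncIntegral ν.negPart R₀ + (ε * q / 2) / q * R ^ (2 - β) := by
    intro R hR
    refine le_add_mul_rpow_of_le_half hα (by linarith) (by positivity)
      (fun R hR hle => truncIntegral_mono hm hR hle) (fun R hRR => ?_) hR
    have hR2 : 2 ≤ R := hR₀.trans hRR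
    have hRpos : 0 < R := by linarith
    refine (truncIntegral_le_half hm hR2).trans ((add_le_add_iff_left _).2 ?_)
    have h1 := setIntegral_sq_norm_le_GMinus hm (r := 2 / R) (by rw [div_le_one hRpos]; exact hR2)
    have h2 := hR₁ R ((le_max_left _ _).trans hRR)
    calc R ^ 2 * ∫ x in {x : E d | ‖x‖ ≤ 2 / R}, ‖x‖ ^ 2 ∂ν.negPart
        ≤ R ^ 2 * (d * (ε * q / (2 * (d + 1) * 2 ^ β) * (2 / R) ^ β)) := by
          gcongr
          exact h1.trans (by gcongr)
      _ ≤ R ^ 2 * ((d + 1) * (ε * q / (2 * (d + 1) * 2 ^ β) * (2 / R) ^ β)) := by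
          gcongr
          linarith
      _ = ε * q / 2 * R ^ (2 - β) := by
          rw [Real.div_rpow zero_le_two hRpos.le, Real.rpow_sub hRpos, Real.rpow_two]
          field_simp
  have hlarge : ∀ᶠ R : ℝ in atTop, truncIntegral ν.negPart R₀ ≤ ε / 2 * R ^ (2 - β) :=
    ((tendsto_rpow_atTop hα).const_mul_atTop (by positivity : 0 < ε / 2)).eventually_ge_atTop _
  filter_upwards [hlarge, eventually_ge_atTop 0] with R h1 h2
  have h3 := hb R h2
  have h4 : (ε * q / 2) / q = ε / 2 := by field_simp
  rw [h4] at h3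
  linarith

lemma OreyCondition.GMinus_le {ν : LocalSignedMeasure d} {β : ℝ} (h : OreyCondition ν β) {ε : ℝ}
    (hε : 0 < ε) : ∀ᶠ r in 𝓝[>] (0 : ℝ), GMinus ν r ≤ ε * r ^ β := by
  have h1 : limsup (fun r : ℝ => ((r ^ (-β) * GMinus ν r : ℝ) : EReal)) (𝓝[>] 0) < (ε : EReal) := by
    rw [h.2]
    exact_mod_cast hε
  filter_upwards [eventually_lt_of_limsup_lt h1, self_mem_nhdsWithin] with r hr hr0
  have hr0 : 0 < r := hr0
  have hr' : r ^ (-β) * GMinus ν r < ε := by exact_mod_cast hr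
  rw [Real.rpow_neg hr0.le, inv_mul_lt_iff₀ (by positivity)] at hr'
  linarith

lemma OreyCondition.exists_le_GPlus {ν : LocalSignedMeasure d} {β : ℝ} (h : OreyCondition ν β) :
    ∃ c : ℝ, 0 < c ∧ ∀ᶠ r in 𝓝[>] (0 : ℝ), c * r ^ β ≤ GPlus ν r := by
  have h1 := h.1
  rw [h.2] at h1
  -- A real number in between exists even when the limit inferior is `+∞`.
  obtain ⟨c, hc0, hc⟩ := EReal.lt_iff_exists_real_btwn.1 h1
  refine ⟨c, by exact_mod_cast hc0, ?_⟩
  filter_upwards [eventually_lt_of_lt_liminf hc, self_mem_nhdsWithin] with r hr hr0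
  have hr0 : 0 < r := hr0
  have hr' : c < r ^ (-β) * GPlus ν r := by exact_mod_cast hr
  rw [Real.rpow_neg hr0.le, lt_inv_mul_iff₀ (by positivity)] at hr'
  linarith

theorem HasCharTriplet.exp_decay_of_oreyCondition {μ : Measure (E d)} [IsProbabilityMeasure μ]
    {A : Matrix (Fin d) (Fin d) ℝ} {ν : LocalSignedMeasure d} {γ : E d}
    (h : HasCharTriplet μ A ν γ) {β : ℝ} (hβ : β < 2) (hO : OreyCondition ν β) :
    ∃ c : ℝ, 0 < c ∧
      ∀ᶠ z in cocompact (E d), ‖charFun μ z‖ ≤ Real.exp (-(c * ‖z‖ ^ (2 - β))) := by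
  obtain ⟨c, hc, hG⟩ := hO.exists_le_GPlus
  have hnorm := tendsto_norm_cocompact_atTop (E := E d)
  set c' : ℝ := 2 / Real.pi ^ 2 * c
  have hc' : 0 < c' := by positivity
  refine ⟨c' / 2, by positivity, ?_⟩
  -- With `c' / 4`, and the factor `2` in `cosIntegral_le`, the `ν⁻` term uses up half of the lower
  -- bound `c' * ‖z‖ ^ (2 - β)` for the `ν⁺` term.
  filter_upwards [hnorm.eventually (eventually_truncIntegral_negPart_le h.2.1.2 hβ
      (fun ε hε => hO.GMinus_le hε) (show 0 < c' / 4 by positivity)),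
    (tendsto_inv_atTop_nhdsGT_zero.comp hnorm).eventually hG,
    hnorm.eventually_ge_atTop 1] with z h1 h2 h3
  have hz : 0 < ‖z‖ := by linarith
  have h4 := sq_norm_mul_GPlus_le_cosIntegral h.2.1.1 h3
  have h5 := cosIntegral_le h.2.1.2 z
  have h6 : c' * ‖z‖ ^ (2 - β) ≤ cosIntegral ν.posPart z := by
    refine le_trans ?_ h4
    calc c' * ‖z‖ ^ (2 - β) = 2 / Real.pi ^ 2 * (‖z‖ ^ 2 * (c * (‖z‖⁻¹) ^ β)) := by
          rw [Real.rpow_sub hz, Real.rpow_two, Real.inv_rpow hz.le]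
          simp only [c']
          ring
      _ ≤ _ := by
          gcongr
          exact h2
  rw [h.norm_charFun, Real.exp_le_exp]
  linarith [h.quadForm_nonneg z]

end QID

theorem mainTheorem8 (d : ℕ) (μ : Measure (QID.E d))
    (hμ : QID.IsQuasiInfinitelyDivisible μ)
    (A : Matrix (Fin d) (Fin d) ℝ) (ν : QID.LocalSignedMeasure d) (γ : QID.E d)
    (hA : QID.HasCharTriplet μ A ν γ)
    (h : A.PosDef ∨ ∃ β : ℝ, 0 < β ∧ β < 2 ∧ QID.OreyCondition ν β) :
    μ ≪ volume ∧
      ∃ f : QID.E d → ℝ, (∀ x, 0 ≤ f x) ∧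
        μ = volume.withDensity (fun x => ENNReal.ofReal (f x)) ∧
        ContDiff ℝ ∞ f ∧
        ∀ n : ℕ, Tendsto (iteratedFDeriv ℝ n f) (cocompact (QID.E d)) (𝓝 0) := by
  have : IsProbabilityMeasure μ := hμ.1
  refine QID.exists_smooth_density fun n => ?_
  rcases h with h | ⟨β, -, hβ2, hO⟩
  · obtain ⟨c, hc, hdecay⟩ := hA.exp_decay_of_posDef h
    exact QID.integrable_pow_mul_of_exp_decay continuous_charFun hc two_pos hdecay n
  · obtain ⟨c, hc, hdecay⟩ := hA.exp_decay_of_oreyCondition hβ2 hO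
    exact QID.integrable_pow_mul_of_exp_decay continuous_charFun hc (by linarith) hdecay n
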